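/- Let $m\ge 1$, $n\ge 0$, $r\ge 1$ be integers, and let $\mathrm{S}^m(\mathbb{C}^{n+1})$ be the space of symmetric tensors of order $m$ on $\mathbb{C}^{n+1}$, where vectors $u\in\mathbb{C}^{n+1}$ are indexed as $u=(u_0,\ldots,u_n)$. Let $\sigma_r\subseteq\mathbb{P}\,\mathrm{S}^m(\mathbb{C}^{n+1})$ be the Zariski closure of the set of classes of the nonzero tensors of the form $u_1^{\otimes m}+\cdots+u_r^{\otimes m}$ with $u_1,\ldots,u_r\in\mathbb{C}^{n+1}$; it is an irreducible projective variety. Let $\mathbb{P}(\mathbb{C}^{n+1})^r$ denote the projectivization of the vector space $(\mathbb{C}^{n+1})^r$, of dimension $r(n+1)-1$. For $\mathcal{F}\in\sigma_r$ put $$\mathrm{fiber}_r(\mathcal{F})=\Big\{(u_1,\ldots,u_r)\in\mathbb{P}(\mathbb{C}^{n+1})^r:\ \mathcal{F}=\sum_{i=1}^r u_i^{\otimes m}\Big\},$$ where the equality is one of points of $\mathbb{P}\,\mathrm{S}^m(\mathbb{C}^{n+1})$ (in particular the sum is nonzero), and let $$U_0=\big\{(u_1,\ldots,u_r)\in\mathbb{P}(\mathbb{C}^{n+1})^r:\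 (u_1)_0\cdots(u_r)_0\neq 0\big\}.$$ Let $d:=r(n+1)-1-\dim\sigma_r$. (i) If $d=0$, then $\mathrm{fiber}_r(\mathcal{F})\subseteq U_0$ for a general $\mathcal{F}\in\sigma_r$. (ii) If $d>0$, then $\mathrm{fiber}_r(\mathcal{F})\cap S\subseteq U_0$ for a general $\mathcal{F}\in\sigma_r$ and a general linear subspace $S\subseteq\mathbb{P}(\mathbb{C}^{n+1})^r$ of codimension $d$. Here a property holds for a general point of an irreducible variety $X$ if it holds on a dense Zariski-open subset of $X$; in (ii), $X$ is the product of $\sigma_r$ and the Grassmannian of linear subspaces of codimension $d$ of $\mathbb{P}(\mathbb{C}^{n+1})^r$. -/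

import Mathlib

open scoped Topology LinearAlgebra.Projectivization

noncomputable section

namespace SymDecomp

section Zariski

variable {V : Type*} [AddCommGroup V] [Module ℂ V]

/-- The value at `v` of a polynomial in the linear forms on `V`. For finite-dimensional `V`, these
polynomials induce exactly the polynomial functions on `V`, independently of any basis. -/
def value (p : MvPolynomial (Module.Dual ℂ V) ℂ) (v : V) : ℂ :=
  MvPolynomial.eval (fun φ : Module.Dual ℂ V => φ v) p

variable (V) in
/-- The Zariski topology on the vector space `V` (seen as affine space): the sets `{p ≠ 0}` form
a basis of open sets. -/
@[reducible] def affineZariski : TopologicalSpace V :=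
  TopologicalSpace.generateFrom
    {U | ∃ p : MvPolynomial (Module.Dual ℂ V) ℂ, U = {v | value p v ≠ 0}}

variable (V) in
/-- The Zariski topology on the projective space `ℙ(V)`: the sets `{p ≠ 0}`, with `p` homogeneous,
form a basis of open sets. -/
@[reducible] def zariski : TopologicalSpace (ℙ ℂ V) :=
  TopologicalSpace.generateFrom
    {U | ∃ (k : ℕ) (p : MvPolynomial (Module.Dual ℂ V) ℂ), p.IsHomogeneous k ∧
      U = {x | value p x.rep ≠ 0}}

/-- The homogeneous ideal of a subset of `ℙ(V)`, generated by the homogeneous polynomials that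
vanish on it. -/
def homogeneousIdeal (X : Set (ℙ ℂ V)) : Ideal (MvPolynomial (Module.Dual ℂ V) ℂ) :=
  Ideal.span {p | (∃ k : ℕ, p.IsHomogeneous k) ∧ ∀ x ∈ X, value p x.rep = 0}

/-- The homogeneous coordinate ring of a projective variety. -/
abbrev CoordinateRing (X : Set (ℙ ℂ V)) : Type _ :=
  MvPolynomial (Module.Dual ℂ V) ℂ ⧸ homogeneousIdeal X

/-- The dimension of an irreducible projective variety: the transcendence degree over `ℂ` of its
homogeneous coordinate ring, minus one (this is the transcendence degree of its function field). -/
def projDim (X : Set (ℙ ℂ V)) : ℤ :=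
  (Cardinal.toNat (Algebra.trdeg ℂ (CoordinateRing X)) : ℤ) - 1

end Zariski

section Generic

/-- `P` holds for a general point of `A`: for a topology `t`, there is an open set whose trace
on `A` is dense in `A` and consists of points at which `P` holds. -/
def Generically {Y : Type*} (t : TopologicalSpace Y) (A : Set Y) (P : Y → Prop) : Prop :=
  ∃ U : Set Y, IsOpen[t] U ∧ A ⊆ closure[t] (A ∩ U) ∧ ∀ y ∈ A ∩ U, P y

end Generic

section Grassmannian

/-- The Grassmannian of linear subspaces of `E` of codimension `d`. These are also the projective
linear subspaces of `ℙ(E)` of codimension `d`. -/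
def Gr (E : Type*) [AddCommGroup E] [Module ℂ E] (d : ℕ) : Type _ :=
  {S : Submodule ℂ E // Module.finrank ℂ (E ⧸ S) = d}

variable (V : Type*) [AddCommGroup V] [Module ℂ V] (E : Type*) [AddCommGroup E] [Module ℂ E]

/-- The subspace cut out by `d` linearly independent linear forms, the forms being the coordinates
of a surjective linear map to `ℂ ^ d`. -/
def Gr.ofForms {E : Type*} [AddCommGroup E] [Module ℂ E] {d : ℕ}
    (L : {L : E →ₗ[ℂ] (Fin d → ℂ) // Function.Surjective L}) : Gr E d :=
  ⟨LinearMap.ker L.1, by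
    rw [(L.1.quotKerEquivOfSurjective L.2).finrank_eq, Module.finrank_fin_fun]⟩

/-- Homogeneous coordinates of points of `ℙ(V) × Gr(E, d)`: pairs of a nonzero vector and of a
tuple of `d` linearly independent linear forms. -/
def Frames (d : ℕ) : Type _ :=
  {q : V × (E →ₗ[ℂ] (Fin d → ℂ)) // q.1 ≠ 0 ∧ Function.Surjective q.2}

variable {V E} in
/-- The point of `ℙ(V) × Gr(E, d)` with given homogeneous coordinates. -/
def Frames.toPoint {d : ℕ} (q : Frames V E d) : ℙ ℂ V × Gr E d :=
  (Projectivization.mk ℂ q.1.1 q.2.1, Gr.ofForms ⟨q.1.2, q.2.2⟩)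

/-- The Zariski topology on the product variety `ℙ(V) × Gr(E, d)` (this is finer than the product
of the Zariski topologies): the quotient of the Zariski topology on the homogeneous coordinates,
i.e. the quotient by `GL_1 × GL_d` of an open subset of the affine space
`V × Hom(E, ℂ ^ d)`. -/
@[reducible] def zariskiProd (d : ℕ) : TopologicalSpace (ℙ ℂ V × Gr E d) :=
  TopologicalSpace.coinduced Frames.toPoint
    (TopologicalSpace.induced (fun q : Frames V E d => q.1)
      (affineZariski (V × (E →ₗ[ℂ] (Fin d → ℂ)))))

end Grassmannian

section Tensors

/-- The space of symmetric tensors of order `m` on `ℂ ^ (n + 1)`: arrays indexed by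
`(i_1, …, i_m)`, `0 ≤ i_k ≤ n`, invariant under permutations of the indices. -/
def SymTensor (n m : ℕ) : Submodule ℂ ((Fin m → Fin (n + 1)) → ℂ) where
  carrier := {F | ∀ (π : Equiv.Perm (Fin m)) (i : Fin m → Fin (n + 1)), F (i ∘ π) = F i}
  add_mem' := fun ha hb π i => by simp [ha π i, hb π i]
  zero_mem' := fun _ _ => rfl
  smul_mem' := fun c _ ha π i => by simp [ha π i]

/-- The symmetric tensor power `u ⊗ ⋯ ⊗ u` (`m` factors). -/
def tensorPow {n : ℕ} (m : ℕ) (u : Fin (n + 1) → ℂ) : SymTensor n m :=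
  ⟨fun i => ∏ k, u (i k), fun π i => Equiv.prod_comp π (fun k => u (i k))⟩

/-- The vector space `(ℂ ^ (n + 1)) ^ r` of `r`-tuples of vectors. -/
abbrev Tuples (n r : ℕ) : Type := Fin r → Fin (n + 1) → ℂ

/-- The sum `u_1 ^ ⊗m + ⋯ + u_r ^ ⊗m`. -/
def powerSum {n r : ℕ} (m : ℕ) (u : Tuples n r) : SymTensor n m :=
  ∑ i, tensorPow m (u i)

/-- The `r`-th secant variety `σ_r` of the Veronese variety: the Zariski closure in the
projective space of symmetric tensors of the classes of the sums `u_1 ^ ⊗m + ⋯ + u_r ^ ⊗m`. -/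
def secant (n m r : ℕ) : Set (ℙ ℂ (SymTensor n m)) :=
  closure[zariski (SymTensor n m)]
    {F | ∃ (u : Tuples n r) (h : powerSum m u ≠ 0), F = Projectivization.mk ℂ (powerSum m u) h}

/-- The decomposing tuples of length `r` of `F`: the classes in `ℙ((ℂ ^ (n + 1)) ^ r)` of tuples
such that `F = u_1 ^ ⊗m + ⋯ + u_r ^ ⊗m` in the projective space of symmetric tensors. -/
def fiber {n m : ℕ} (r : ℕ) (F : ℙ ℂ (SymTensor n m)) : Set (ℙ ℂ (Tuples n r)) :=
  {u | ∃ h : powerSum m u.rep ≠ 0, F = Projectivization.mk ℂ (powerSum m u.rep) h}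

/-- The tuples all of whose vectors have a nonzero coordinate of index `0`. -/
def U₀ (n r : ℕ) : Set (ℙ ℂ (Tuples n r)) :=
  {u | ∏ i, u.rep i 0 ≠ 0}

/-- The points of the projective linear subspace of `ℙ(E)` attached to `S`. -/
def Gr.points {E : Type*} [AddCommGroup E] [Module ℂ E] {d : ℕ} (S : Gr E d) : Set (ℙ ℂ E) :=
  {u | u.submodule ≤ S.1}

end Tensors

end SymDecomp

end

/-! The proof is a dimension count, made effective by elimination. Put `N = r(n+1)` and let `e` be
the dimension of the affine cone over the secant variety, so that `e + d = N`. There are `e`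
polynomials `x s` on symmetric tensors that stay algebraically independent when evaluated at power
sums (`exists_independent_values`).

A linear subspace of codimension `d` is the kernel of a map `L` with `dN` entries. Consider the
pairs `(u, L)` with `L u = 0`, one coordinate of `u` zero and another nonzero. They depend on `(N -
1) + d(N - 1) = dN + e - 1` parameters, one fewer than the number of entries of `L` and values `x s
(powerSum m u)` together. These quantities therefore satisfy a nonzero polynomial relation
(`exists_relation_of_map_eq_zero`), which is not an identity on all pairs `(powerSum m u, L)`
because the `x s` are independent. The product of these relations over all positions of the two
coordinates is a single function `G` (`exists_polyFun_vanishing`).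

Where `G` is nonzero, no tuple of the fiber lying on the kernel has a zero leading coordinate
(`mem_U₀_of_vanishing`). Density of this locus needs no irreducibility theorem: polynomial
conditions are pulled back along `powerSum` to a vector space, where two nonzero polynomial
functions have a common point of nonvanishing. For `d = 0` the map `L` carries no condition. -/

namespace SymDecomp

/-! ### Polynomial functions on a vector space -/

section PolynomialFunctions

variable {V W : Type*} [AddCommGroup V] [Module ℂ V] [AddCommGroup W] [Module ℂ W]

variable (V) in
/-- The algebra of polynomial functions on the vector space `V`. -/
noncomputable def polyFun : Subalgebra ℂ (V → ℂ) :=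
  (MvPolynomial.aeval (fun (φ : Module.Dual ℂ V) (v : V) => φ v)).range

theorem aeval_apply {ι X : Type*} (z : ι → X → ℂ) (q : MvPolynomial ι ℂ) (v : X) :
    MvPolynomial.aeval z q v = MvPolynomial.eval (fun i => z i v) q := by
  induction q using MvPolynomial.induction_on with
  | C a => simp
  | add p q hp hq => simp [hp, hq]
  | mul_X p i hp => simp [hp]

theorem mem_polyFun_iff {g : V → ℂ} : g ∈ polyFun V ↔ ∃ p, value p = g := by
  have key : ∀ p : MvPolynomial (Module.Dual ℂ V) ℂ,
      MvPolynomial.aeval (fun (φ : Module.Dual ℂ V) (v : V) => φ v) p = value p :=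
    fun p => funext fun v => aeval_apply _ _ _
  simp only [polyFun, AlgHom.mem_range, key]

theorem value_mem_polyFun (p : MvPolynomial (Module.Dual ℂ V) ℂ) : value p ∈ polyFun V :=
  mem_polyFun_iff.2 ⟨p, rfl⟩

theorem dual_mem_polyFun (φ : Module.Dual ℂ V) : (fun v => φ v) ∈ polyFun V :=
  mem_polyFun_iff.2 ⟨MvPolynomial.X φ, funext fun v => by simp [value]⟩

theorem const_mem_polyFun (c : ℂ) : (fun _ => c) ∈ polyFun V :=
  (polyFun V).algebraMap_mem c

theorem mul_mem_polyFun {f g : V → ℂ} (hf : f ∈ polyFun V) (hg : g ∈ polyFun V) :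
    (fun v => f v * g v) ∈ polyFun V :=
  mul_mem hf hg

theorem sum_mem_polyFun {ι : Type*} (s : Finset ι) {f : ι → V → ℂ}
    (hf : ∀ i ∈ s, f i ∈ polyFun V) : (fun v => ∑ i ∈ s, f i v) ∈ polyFun V := by
  convert sum_mem hf using 1
  ext v; simp

theorem prod_mem_polyFun {ι : Type*} (s : Finset ι) {f : ι → V → ℂ}
    (hf : ∀ i ∈ s, f i ∈ polyFun V) : (fun v => ∏ i ∈ s, f i v) ∈ polyFun V := by
  convert prod_mem hf using 1
  ext v; simp

theorem eval_mem_polyFun {ι : Type*} {z : ι → V → ℂ} (hz : ∀ i, z i ∈ polyFun V)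
    (q : MvPolynomial ι ℂ) : (fun v => MvPolynomial.eval (fun i => z i v) q) ∈ polyFun V := by
  induction q using MvPolynomial.induction_on with
  | C a => simpa using const_mem_polyFun a
  | add p q hp hq =>
    simp only [map_add]
    exact add_mem hp hq
  | mul_X p i hp =>
    simpa only [map_mul, MvPolynomial.eval_X] using mul_mem_polyFun hp (hz i)

theorem comp_mem_polyFun {T : V → W} (hT : ∀ φ : Module.Dual ℂ W, (fun v => φ (T v)) ∈ polyFun V)
    {g : W → ℂ} (hg : g ∈ polyFun W) : (fun v => g (T v)) ∈ polyFun V := by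
  obtain ⟨p, rfl⟩ := mem_polyFun_iff.1 hg
  exact eval_mem_polyFun hT p

theorem comp_linear_mem_polyFun (T : V →ₗ[ℂ] W) {g : W → ℂ} (hg : g ∈ polyFun W) :
    (fun v => g (T v)) ∈ polyFun V :=
  comp_mem_polyFun (fun φ => dual_mem_polyFun (φ ∘ₗ T)) hg

theorem comp_fst_mem_polyFun {g : V → ℂ} (hg : g ∈ polyFun V) :
    (fun q : V × W => g q.1) ∈ polyFun (V × W) :=
  comp_linear_mem_polyFun (LinearMap.fst ℂ V W) hg

theorem comp_snd_mem_polyFun {g : W → ℂ} (hg : g ∈ polyFun W) :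
    (fun q : V × W => g q.2) ∈ polyFun (V × W) :=
  comp_linear_mem_polyFun (LinearMap.snd ℂ V W) hg

theorem comp_prodMap_mem_polyFun {V' : Type*} [AddCommGroup V'] [Module ℂ V'] {T : V → V'}
    (hT : ∀ φ : Module.Dual ℂ V', (fun v => φ (T v)) ∈ polyFun V) {g : V' × W → ℂ}
    (hg : g ∈ polyFun (V' × W)) : (fun q : V × W => g (T q.1, q.2)) ∈ polyFun (V × W) := by
  refine comp_mem_polyFun (T := fun q : V × W => (T q.1, q.2)) (fun φ => ?_) hg
  have h : ∀ q : V × W, φ (T q.1, q.2) =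
      (φ ∘ₗ LinearMap.inl ℂ V' W) (T q.1) + (φ ∘ₗ LinearMap.inr ℂ V' W) q.2 := fun q => by
    simp [← map_add]
  simp only [h]
  exact add_mem (comp_fst_mem_polyFun (hT (φ ∘ₗ LinearMap.inl ℂ V' W)))
    (comp_snd_mem_polyFun (dual_mem_polyFun (φ ∘ₗ LinearMap.inr ℂ V' W)))

theorem eval_aeval {ι κ : Type*} (P : ι → MvPolynomial κ ℂ) (y : κ → ℂ) (q : MvPolynomial ι ℂ) :
    MvPolynomial.eval y (MvPolynomial.aeval P q) =
      MvPolynomial.eval (fun i => MvPolynomial.eval y (P i)) q := by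
  induction q using MvPolynomial.induction_on with
  | C a => simp [MvPolynomial.algebraMap_eq]
  | add p q hp hq => rw [map_add, map_add, map_add, hp, hq]
  | mul_X p i hp => rw [map_mul, map_mul, map_mul, hp, MvPolynomial.aeval_X, MvPolynomial.eval_X]

theorem exists_eval_eq {κ : Type*} [Fintype κ] {g : (κ → ℂ) → ℂ} (hg : g ∈ polyFun (κ → ℂ)) :
    ∃ P : MvPolynomial κ ℂ, ∀ y, MvPolynomial.eval y P = g y := by
  classical
  obtain ⟨p, rfl⟩ := mem_polyFun_iff.1 hg
  refine ⟨MvPolynomial.aeval (fun φ : Module.Dual ℂ (κ → ℂ) =>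
    ∑ k, MvPolynomial.C (φ (fun i => if k = i then 1 else 0)) * MvPolynomial.X k) p, fun y => ?_⟩
  rw [eval_aeval, value]
  congr 2
  ext φ
  rw [LinearMap.pi_apply_eq_sum_univ φ y]
  simp [mul_comm]

theorem exists_polynomial_line {g : V → ℂ} (hg : g ∈ polyFun V) (a b : V) :
    ∃ P : Polynomial ℂ, ∀ t, P.eval t = g (a + t • b) := by
  obtain ⟨p, rfl⟩ := mem_polyFun_iff.1 hg
  refine ⟨MvPolynomial.aeval (fun φ : Module.Dual ℂ V =>
    Polynomial.C (φ a) + Polynomial.C (φ b) * Polynomial.X) p, fun t => ?_⟩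
  clear hg
  rw [value]
  induction p using MvPolynomial.induction_on with
  | C a => simp [Polynomial.algebraMap_eq]
  | add p q hp hq => rw [map_add, map_add, Polynomial.eval_add, hp, hq]
  | mul_X p i hp =>
    rw [map_mul, map_mul, Polynomial.eval_mul, hp]
    simp [mul_comm t]

/-- Restriction to the line joining the two given points reduces this to one-variable polynomials
over an infinite field. It plays the role of irreducibility of affine space in the density
arguments. -/
theorem exists_ne_zero_and_ne_zero {g h : V → ℂ} (hg : g ∈ polyFun V) (hh : h ∈ polyFun V)
    (hg0 : ∃ v, g v ≠ 0) (hh0 : ∃ v, h v ≠ 0) : ∃ v, g v ≠ 0 ∧ h v ≠ 0 := by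
  obtain ⟨a, ha⟩ := hg0
  obtain ⟨b, hb⟩ := hh0
  obtain ⟨P, hP⟩ := exists_polynomial_line hg a (b - a)
  obtain ⟨Q, hQ⟩ := exists_polynomial_line hh a (b - a)
  have hP0 : P ≠ 0 := fun h0 => ha (by simpa [h0] using (hP 0).symm)
  have hQ0 : Q ≠ 0 := fun h0 => hb (by simpa [h0] using (hQ 1).symm)
  have : ∃ t, (P * Q).eval t ≠ 0 := by
    by_contra! hcon
    exact mul_ne_zero hP0 hQ0 (Polynomial.funext fun t => by simpa using hcon t)
  obtain ⟨t, ht⟩ := this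
  rw [Polynomial.eval_mul, hP, hQ] at ht
  exact ⟨_, left_ne_zero_of_mul ht, right_ne_zero_of_mul ht⟩

theorem exists_prod_ne_zero {ι : Type*} (s : Finset ι) {f : ι → V → ℂ}
    (hf : ∀ i ∈ s, f i ∈ polyFun V) (hf0 : ∀ i ∈ s, ∃ v, f i v ≠ 0) :
    ∃ v, ∏ i ∈ s, f i v ≠ 0 := by
  classical
  induction s using Finset.induction_on with
  | empty => exact ⟨0, by simp⟩
  | insert i s hi ih =>
    obtain ⟨v, h1, h2⟩ := exists_ne_zero_and_ne_zero (hf i (by simp))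
      (prod_mem_polyFun s fun k hk => hf k (by simp [hk])) (hf0 i (by simp))
      (ih (fun k hk => hf k (by simp [hk])) (fun k hk => hf0 k (by simp [hk])))
    exact ⟨v, by rw [Finset.prod_insert hi]; exact mul_ne_zero h1 h2⟩

/-- More polynomial functions than coordinates satisfy a polynomial relation. -/
theorem exists_relation {ι κ : Type*} [Fintype ι] [Fintype κ]
    (hcard : Fintype.card κ < Fintype.card ι) (z : ι → (κ → ℂ) → ℂ)
    (hz : ∀ i, z i ∈ polyFun (κ → ℂ)) :
    ∃ q : MvPolynomial ι ℂ, q ≠ 0 ∧ ∀ y, MvPolynomial.eval (fun i => z i y) q = 0 := by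
  choose P hP using fun i => exists_eval_eq (hz i)
  by_contra! hcon
  -- Without a relation, the family would be larger than the transcendence degree of the polynomial
  -- ring in the variables `κ`.
  have hind : AlgebraicIndependent ℂ P := by
    rw [algebraicIndependent_iff]
    intro q hq
    by_contra hq0
    obtain ⟨y, hy⟩ := hcon q hq0
    apply hy
    simpa only [eval_aeval, hP, map_zero] using congrArg (MvPolynomial.eval y) hq
  have := hind.lift_cardinalMk_le_trdeg
  rw [MvPolynomial.trdeg_of_isDomain] at this
  simp at this
  omega

end PolynomialFunctions

/-! ### Homogeneous components and Zariski-open sets -/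

section Homogeneous

variable {V : Type*} [AddCommGroup V] [Module ℂ V]

theorem value_smul {p : MvPolynomial (Module.Dual ℂ V) ℂ} {k : ℕ} (hp : p.IsHomogeneous k)
    (c : ℂ) (v : V) : value p (c • v) = c ^ k * value p v := by
  simp only [value, MvPolynomial.eval_eq, Finset.mul_sum]
  refine Finset.sum_congr rfl fun s hs => ?_
  have hk : s.degree = k := by
    rw [Finsupp.degree_eq_weight_one]
    exact hp (MvPolynomial.mem_support_iff.1 hs)
  simp only [map_smul, smul_eq_mul, mul_pow, Finset.prod_mul_distrib, Finset.prod_pow_eq_pow_sum]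
  rw [← hk, Finsupp.degree_apply]
  ring

theorem value_eq_sum (p : MvPolynomial (Module.Dual ℂ V) ℂ) (v : V) :
    value p v = ∑ k ∈ Finset.range (p.totalDegree + 1),
      value (MvPolynomial.homogeneousComponent k p) v := by
  conv_lhs => rw [← MvPolynomial.sum_homogeneousComponent p]
  simp [value]

theorem exists_homogeneousComponent_ne_zero {p : MvPolynomial (Module.Dual ℂ V) ℂ} {v : V}
    (h : value p v ≠ 0) : ∃ k, value (MvPolynomial.homogeneousComponent k p) v ≠ 0 := by
  rw [value_eq_sum] at h
  obtain ⟨k, -, hk⟩ := Finset.exists_ne_zero_of_sum_ne_zero h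
  exact ⟨k, hk⟩

/-- Along the line through `v`, the values of `p` form a polynomial in the scalar whose coefficients
are the values of the homogeneous components at `v`. -/
theorem exists_smul_ne_zero {p : MvPolynomial (Module.Dual ℂ V) ℂ} {v : V} {k : ℕ}
    (h : value (MvPolynomial.homogeneousComponent k p) v ≠ 0) :
    ∃ c : ℂ, c ≠ 0 ∧ value p (c • v) ≠ 0 := by
  have hk : k ∈ Finset.range (p.totalDegree + 1) := by
    by_contra hk
    rw [MvPolynomial.homogeneousComponent_eq_zero _ _ (by simpa using hk)] at h
    simp [value] at h
  let P : Polynomial ℂ := ∑ k ∈ Finset.range (p.totalDegree + 1),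
    Polynomial.monomial k (value (MvPolynomial.homogeneousComponent k p) v)
  have hP : P ≠ 0 := by
    intro h0
    have := congrArg (fun Q => Polynomial.coeff Q k) h0
    simp only [P, Polynomial.finsetSum_coeff, Polynomial.coeff_monomial] at this
    rw [Finset.sum_ite_eq' , if_pos hk] at this
    exact h (by simpa using this)
  -- The extra factor `X` makes the scalar nonzero.
  have : ∃ t, (Polynomial.X * P).eval t ≠ 0 := by
    by_contra! hcon
    exact mul_ne_zero Polynomial.X_ne_zero hP (Polynomial.funext fun t => by simpa using hcon t)
  obtain ⟨c, hc⟩ := this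
  rw [Polynomial.eval_mul, Polynomial.eval_X] at hc
  refine ⟨c, left_ne_zero_of_mul hc, ?_⟩
  convert right_ne_zero_of_mul hc using 1
  rw [value_eq_sum]
  simp only [P, Polynomial.eval_finsetSum, Polynomial.eval_monomial]
  refine Finset.sum_congr rfl fun i _ => ?_
  rw [value_smul (MvPolynomial.homogeneousComponent_isHomogeneous i p), mul_comm]

theorem value_mk_rep_ne_zero_iff {p : MvPolynomial (Module.Dual ℂ V) ℂ} {k : ℕ}
    (hp : p.IsHomogeneous k) {v : V} (hv : v ≠ 0) :
    value p (Projectivization.mk ℂ v hv).rep ≠ 0 ↔ value p v ≠ 0 := by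
  obtain ⟨a, ha⟩ := Projectivization.exists_smul_eq_mk_rep ℂ v hv
  rw [← ha, Units.smul_def, value_smul hp]
  simp

theorem isOpen_zariski_ne_zero {p : MvPolynomial (Module.Dual ℂ V) ℂ} {k : ℕ}
    (hp : p.IsHomogeneous k) : IsOpen[zariski V] {x | value p x.rep ≠ 0} :=
  TopologicalSpace.isOpen_generateFrom_of_mem ⟨k, p, hp, rfl⟩

/-- The generating sets are closed under finite intersection, by multiplying equations, so they form
a basis. -/
theorem exists_homogeneous_subset {O : Set (ℙ ℂ V)} (hO : IsOpen[zariski V] O) {x : ℙ ℂ V}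
    (hx : x ∈ O) : ∃ (k : ℕ) (p : MvPolynomial (Module.Dual ℂ V) ℂ), p.IsHomogeneous k ∧
      value p x.rep ≠ 0 ∧ ∀ y : ℙ ℂ V, value p y.rep ≠ 0 → y ∈ O := by
  induction hO with
  | basic s hs =>
    obtain ⟨k, p, hp, rfl⟩ := hs
    exact ⟨k, p, hp, hx, fun y hy => hy⟩
  | univ => exact ⟨0, 1, MvPolynomial.isHomogeneous_one _ _, by simp [value], fun _ _ => trivial⟩
  | inter s t _ _ ihs iht =>
    obtain ⟨k, p, hp, hpx, hps⟩ := ihs hx.1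
    obtain ⟨l, q, hq, hqx, hqt⟩ := iht hx.2
    have hval : ∀ v : V, value (p * q) v = value p v * value q v := fun v => by simp [value]
    refine ⟨k + l, p * q, hp.mul hq, by rw [hval]; exact mul_ne_zero hpx hqx, fun y hy => ?_⟩
    rw [hval] at hy
    exact ⟨hps y (left_ne_zero_of_mul hy), hqt y (right_ne_zero_of_mul hy)⟩
  | sUnion S _ ih =>
    obtain ⟨s, hs, hxs⟩ := hx
    obtain ⟨k, p, hp, hpx, hps⟩ := ih s hs hxs
    exact ⟨k, p, hp, hpx, fun y hy => ⟨s, hs, hps y hy⟩⟩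

theorem isOpen_affineZariski_ne_zero {g : V → ℂ} (hg : g ∈ polyFun V) :
    IsOpen[affineZariski V] {v | g v ≠ 0} := by
  obtain ⟨p, rfl⟩ := mem_polyFun_iff.1 hg
  exact TopologicalSpace.isOpen_generateFrom_of_mem ⟨p, rfl⟩

theorem exists_polyFun_subset {O : Set V} (hO : IsOpen[affineZariski V] O) {x : V} (hx : x ∈ O) :
    ∃ g ∈ polyFun V, g x ≠ 0 ∧ ∀ y, g y ≠ 0 → y ∈ O := by
  induction hO with
  | basic s hs =>
    obtain ⟨p, rfl⟩ := hs
    exact ⟨_, value_mem_polyFun p, hx, fun y hy => hy⟩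
  | univ => exact ⟨1, one_mem _, by simp, fun _ _ => trivial⟩
  | inter s t _ _ ihs iht =>
    obtain ⟨p, hp, hpx, hps⟩ := ihs hx.1
    obtain ⟨q, hq, hqx, hqt⟩ := iht hx.2
    exact ⟨_, mul_mem hp hq, mul_ne_zero hpx hqx, fun y hy =>
      ⟨hps y (left_ne_zero_of_mul hy), hqt y (right_ne_zero_of_mul hy)⟩⟩
  | sUnion S _ ih =>
    obtain ⟨s, hs, hxs⟩ := hx
    obtain ⟨p, hp, hpx, hps⟩ := ih s hs hxs
    exact ⟨p, hp, hpx, fun y hy => ⟨s, hs, hps y hy⟩⟩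

end Homogeneous

/-! ### Power sums and the cone over the secant variety -/

section Secant

variable {n m r : ℕ}

theorem powerSum_apply (u : Tuples n r) (i : Fin m → Fin (n + 1)) :
    (powerSum m u).1 i = ∑ k, ∏ l, u k (i l) := by
  simp [powerSum, tensorPow]

theorem powerSum_smul (c : ℂ) (u : Tuples n r) : powerSum m (c • u) = c ^ m • powerSum m u := by
  ext i
  rw [powerSum_apply, Submodule.coe_smul, Pi.smul_apply, powerSum_apply]
  simp [Finset.prod_mul_distrib, Finset.mul_sum]

/-- An `m`-th root of `c` absorbs the scalar: power sums form a cone, so projective equalities lift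
to equalities of tensors. -/
theorem exists_smul_powerSum (hm : 1 ≤ m) {c : ℂ} (hc : c ≠ 0) (u : Tuples n r) :
    ∃ a : ℂ, a ≠ 0 ∧ powerSum m (a • u) = c • powerSum m u := by
  obtain ⟨a, ha⟩ := IsAlgClosed.exists_pow_nat_eq c (n := m) (by omega)
  refine ⟨a, ?_, by rw [powerSum_smul, ha]⟩
  rintro rfl
  rw [zero_pow (by omega)] at ha
  exact hc ha.symm

theorem coord_mem_polyFun (i : Fin r) (l : Fin (n + 1)) :
    (fun u : Tuples n r => u i l) ∈ polyFun (Tuples n r) :=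
  dual_mem_polyFun (LinearMap.proj l ∘ₗ LinearMap.proj i : Tuples n r →ₗ[ℂ] ℂ)

theorem dual_powerSum_mem_polyFun (φ : Module.Dual ℂ (SymTensor n m)) :
    (fun u => φ (powerSum m u)) ∈ polyFun (Tuples n r) := by
  classical
  obtain ⟨ψ, rfl⟩ := LinearMap.exists_extend φ
  have h : ∀ u : Tuples n r, ψ (powerSum m u).1 = ∑ i : Fin m → Fin (n + 1),
      (∑ k, ∏ l, u k (i l)) * ψ (fun j => if i = j then 1 else 0) := fun u => by
    rw [LinearMap.pi_apply_eq_sum_univ ψ]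
    simp [powerSum_apply]
  simp only [LinearMap.comp_apply, Submodule.subtype_apply, h]
  exact sum_mem_polyFun _ fun i _ => mul_mem_polyFun (sum_mem_polyFun _ fun k _ =>
    prod_mem_polyFun _ fun l _ => coord_mem_polyFun k (i l)) (const_mem_polyFun _)

theorem comp_powerSum_mem_polyFun {g : SymTensor n m → ℂ} (hg : g ∈ polyFun (SymTensor n m)) :
    (fun u => g (powerSum m u)) ∈ polyFun (Tuples n r) :=
  comp_mem_polyFun dual_powerSum_mem_polyFun hg

theorem mk_powerSum_mem_secant (u : Tuples n r) (h : powerSum m u ≠ 0) :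
    Projectivization.mk ℂ (powerSum m u) h ∈ secant n m r :=
  @subset_closure _ (zariski (SymTensor n m)) _ _ ⟨u, h, rfl⟩

/-- A polynomial that does not vanish on the cone over the secant variety does not vanish on the
sums of powers. -/
theorem exists_value_powerSum_ne_zero (hm : 1 ≤ m) {F : ℙ ℂ (SymTensor n m)}
    (hF : F ∈ secant n m r) {p : MvPolynomial (Module.Dual ℂ (SymTensor n m)) ℂ}
    (h : value p F.rep ≠ 0) :
    ∃ u : Tuples n r, powerSum m u ≠ 0 ∧ value p (powerSum m u) ≠ 0 := by
  obtain ⟨k, hk⟩ := exists_homogeneousComponent_ne_zero h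
  have hhom := MvPolynomial.homogeneousComponent_isHomogeneous k p
  obtain ⟨y, hy, u, hu, rfl⟩ := (@mem_closure_iff _ (zariski (SymTensor n m)) _ _).1 hF _
    (isOpen_zariski_ne_zero hhom) hk
  obtain ⟨c, hc, hpc⟩ := exists_smul_ne_zero ((value_mk_rep_ne_zero_iff hhom hu).1 hy)
  obtain ⟨a, -, ha⟩ := exists_smul_powerSum hm hc u
  exact ⟨a • u, by rw [ha]; exact smul_ne_zero hc hu, by rwa [ha]⟩

/-- Since power sums are stable under scaling, a polynomial vanishing on all of them has homogeneous
components vanishing on the whole secant variety. -/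
theorem exists_value_powerSum_ne_zero_of_notMem (hm : 1 ≤ m)
    {p : MvPolynomial (Module.Dual ℂ (SymTensor n m)) ℂ}
    (h : p ∉ homogeneousIdeal (secant n m r)) :
    ∃ u : Tuples n r, value p (powerSum m u) ≠ 0 := by
  by_contra! hcon
  apply h
  rw [← MvPolynomial.sum_homogeneousComponent p]
  refine sum_mem fun k _ => Ideal.subset_span
    ⟨⟨k, MvPolynomial.homogeneousComponent_isHomogeneous k p⟩, fun x hx => ?_⟩
  by_contra hk
  obtain ⟨u, -, hu⟩ := exists_value_powerSum_ne_zero hm hx hk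
  obtain ⟨c, hc, hpc⟩ := exists_smul_ne_zero hu
  obtain ⟨a, -, ha⟩ := exists_smul_powerSum hm hc u
  exact hpc (ha ▸ hcon (a • u))

theorem exists_powerSum_ne_zero (hr : 1 ≤ r) : ∃ u : Tuples n r, powerSum m u ≠ 0 := by
  refine ⟨fun i l => 1, fun h => ?_⟩
  have := congrArg (fun F : SymTensor n m => F.1 0) h
  simp only [powerSum_apply] at this
  simp at this
  omega

theorem one_notMem_homogeneousIdeal (hr : 1 ≤ r) : 1 ∉ homogeneousIdeal (secant n m r) := by
  obtain ⟨u, hu⟩ := exists_powerSum_ne_zero (n := n) (m := m) hr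
  intro h
  have hle : homogeneousIdeal (secant n m r) ≤ RingHom.ker (MvPolynomial.eval
      (fun φ : Module.Dual ℂ (SymTensor n m) => φ (Projectivization.mk ℂ _ hu).rep)) :=
    Ideal.span_le.2 fun p hp => hp.2 _ (mk_powerSum_mem_secant u hu)
  simpa using hle h

theorem exists_algebraicIndependent {A : Type*} [CommRing A] [Algebra ℂ A] [Nontrivial A] {e : ℕ}
    (he : Cardinal.toNat (Algebra.trdeg ℂ A) = e) :
    ∃ x : Fin e → A, AlgebraicIndependent ℂ x := by
  rcases Nat.eq_zero_or_pos e with rfl | hpos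
  · exact ⟨Fin.elim0, algebraicIndependent_empty_type_iff.2 (algebraMap ℂ A).injective⟩
  · have htr : Algebra.trdeg ℂ A = e := ((Cardinal.toNat_eq_iff hpos.ne').1 he)
    -- The transcendence degree is a supremum of cardinals. It is attained here because a natural
    -- number is not a limit cardinal.
    have : Nonempty {s : Set A // AlgebraicIndepOn ℂ id s} :=
      ⟨⟨∅, algebraicIndependent_empty_type_iff.2 (algebraMap ℂ A).injective⟩⟩
    obtain ⟨⟨s, hs⟩, hcard⟩ := exists_eq_ciSup_of_not_isSuccLimit
      (f := fun s : {s : Set A // AlgebraicIndepOn ℂ id s} => Cardinal.mk s.1)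
      Cardinal.bddAbove_of_small (by
        change ¬ Order.IsSuccLimit (Algebra.trdeg ℂ A)
        rw [htr]
        exact Cardinal.not_isSuccLimit_natCast e)
    replace hcard : Cardinal.mk s = e := hcard.trans htr
    have hs' : Cardinal.lift.{0} (Cardinal.mk s) = Cardinal.lift (Cardinal.mk (Fin e)) := by
      simpa using hcard
    obtain ⟨f⟩ := Cardinal.lift_mk_eq'.1 hs'
    exact ⟨fun i => (f.symm i : A), hs.comp _ f.symm.injective⟩

/-- As many polynomials as the dimension of the cone over the secant variety, algebraically
independent on the sums of powers. -/
theorem exists_independent_values (hm : 1 ≤ m) (hr : 1 ≤ r) {e : ℕ}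
    (he : Cardinal.toNat (Algebra.trdeg ℂ (CoordinateRing (secant n m r))) = e) :
    ∃ x : Fin e → SymTensor n m → ℂ, (∀ s, x s ∈ polyFun (SymTensor n m)) ∧
      ∀ c : MvPolynomial (Fin e) ℂ, c ≠ 0 →
        ∃ u : Tuples n r, MvPolynomial.eval (fun s => x s (powerSum m u)) c ≠ 0 := by
  have : Nontrivial (CoordinateRing (secant n m r)) := Ideal.Quotient.nontrivial_iff.2
    ((Ideal.ne_top_iff_one _).2 (one_notMem_homogeneousIdeal hr))
  obtain ⟨x, hx⟩ := exists_algebraicIndependent he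
  choose X hX using fun s => Ideal.Quotient.mk_surjective (x s)
  refine ⟨fun s => value (X s), fun s => value_mem_polyFun _, fun c hc => ?_⟩
  have hnot : MvPolynomial.aeval X c ∉ homogeneousIdeal (secant n m r) := by
    intro hmem
    refine hc ((algebraicIndependent_iff.1 hx) c ?_)
    rw [← Ideal.Quotient.eq_zero_iff_mem] at hmem
    have := MvPolynomial.comp_aeval_apply (f := X)
      (Ideal.Quotient.mkₐ ℂ (homogeneousIdeal (secant n m r))) c
    simp only [Ideal.Quotient.mkₐ_eq_mk, hX] at this
    rw [← this, hmem]
  obtain ⟨u, hu⟩ := exists_value_powerSum_ne_zero_of_notMem hm hnot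
  refine ⟨u, ?_⟩
  rwa [value, eval_aeval] at hu

end Secant

/-! ### Elimination: the relation forced by a zero coordinate -/

section Relation

variable {n m r d : ℕ}

/-- The tuple with a one in the given position and zeros elsewhere. -/
def unitTuple (k : Fin r × Fin (n + 1)) : Tuples n r :=
  Pi.single k.1 (Pi.single k.2 1)

theorem eq_sum_unitTuple (u : Tuples n r) :
    u = ∑ k : Fin r × Fin (n + 1), u k.1 k.2 • unitTuple k := by
  ext i l
  simp [unitTuple, Fintype.sum_prod_type, Finset.sum_apply, Pi.single_apply, ite_apply]

theorem map_tuple_apply (L : Tuples n r →ₗ[ℂ] (Fin d → ℂ)) (u : Tuples n r) (a : Fin d) :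
    L u a = ∑ k : Fin r × Fin (n + 1), u k.1 k.2 * L (unitTuple k) a := by
  conv_lhs => rw [eq_sum_unitTuple u]
  simp

theorem exists_map_unitTuple_eq (w : Fin d × (Fin r × Fin (n + 1)) → ℂ) :
    ∃ L : Tuples n r →ₗ[ℂ] (Fin d → ℂ), ∀ a k, L (unitTuple k) a = w (a, k) := by
  refine ⟨∑ k : Fin r × Fin (n + 1), LinearMap.smulRight
    (LinearMap.proj k.2 ∘ₗ LinearMap.proj k.1 : Tuples n r →ₗ[ℂ] ℂ) (fun a => w (a, k)), ?_⟩
  intro a k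
  simp [unitTuple, Fintype.sum_prod_type, Finset.sum_apply, Pi.single_apply, ite_apply]

theorem map_unitTuple_mem_polyFun {V : Type*} [AddCommGroup V] [Module ℂ V]
    (a : Fin d) (k : Fin r × Fin (n + 1)) :
    (fun q : V × (Tuples n r →ₗ[ℂ] (Fin d → ℂ)) => q.2 (unitTuple k) a) ∈
      polyFun (V × (Tuples n r →ₗ[ℂ] (Fin d → ℂ))) :=
  dual_mem_polyFun ((LinearMap.proj a : (Fin d → ℂ) →ₗ[ℂ] ℂ) ∘ₗ
    (LinearMap.applyₗ (unitTuple k) : (Tuples n r →ₗ[ℂ] (Fin d → ℂ)) →ₗ[ℂ] (Fin d → ℂ)) ∘ₗ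
    LinearMap.snd ℂ V (Tuples n r →ₗ[ℂ] (Fin d → ℂ)))

theorem comp_powerSum_prod_mem_polyFun {H : Type*} [AddCommGroup H] [Module ℂ H]
    {G : SymTensor n m × H → ℂ} (hG : G ∈ polyFun (SymTensor n m × H)) :
    (fun v : Tuples n r × H => G (powerSum m v.1, v.2)) ∈ polyFun (Tuples n r × H) :=
  comp_prodMap_mem_polyFun dual_powerSum_mem_polyFun hG

theorem eval_sumRingEquiv {S T : Type*} (w : S → ℂ) (a : T → ℂ) (q : MvPolynomial (S ⊕ T) ℂ) :
    MvPolynomial.eval w (MvPolynomial.map (MvPolynomial.eval a)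
      (MvPolynomial.sumRingEquiv ℂ S T q)) = MvPolynomial.eval (Sum.elim w a) q := by
  induction q using MvPolynomial.induction_on with
  | C c => simp
  | add p q hp hq => rw [map_add, map_add, map_add, map_add, hp, hq]
  | mul_X p i hp =>
    rw [map_mul, map_mul, map_mul, map_mul, hp]
    rcases i with i | i <;> simp

/-- The linear maps that vanish at a tuple with one prescribed zero coordinate and one prescribed
nonzero coordinate satisfy a polynomial relation. -/
theorem exists_relation_of_map_eq_zero {e : ℕ} (hed : e + d = r * (n + 1))
    {x : Fin e → SymTensor n m → ℂ} (hx : ∀ s, x s ∈ polyFun (SymTensor n m))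
    (b j : Fin r × Fin (n + 1)) :
    ∃ q : MvPolynomial ((Fin d × (Fin r × Fin (n + 1))) ⊕ Fin e) ℂ, q ≠ 0 ∧
      ∀ (u : Tuples n r) (L : Tuples n r →ₗ[ℂ] (Fin d → ℂ)), u b.1 b.2 = 0 → u j.1 j.2 ≠ 0 →
        L u = 0 → MvPolynomial.eval (Sum.elim (fun ak => L (unitTuple ak.2) ak.1)
          (fun s => x s (powerSum m u))) q = 0 := by
  classical
  -- The parameters are the coordinates of `u` away from `b`, and the columns of `L` away from `j`;
  -- column `j` is determined by `L u = 0`.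
  let κ := {k // k ≠ b} ⊕ (Fin d × {k // k ≠ j})
  let U : (κ → ℂ) → Tuples n r := fun y i l =>
    if h : (i, l) ≠ b then y (.inl ⟨(i, l), h⟩) else 0
  have hU : ∀ i l, (fun y => U y i l) ∈ polyFun (κ → ℂ) := fun i l => by
    by_cases h : (i, l) ≠ b
    · simp only [U, dif_pos h]
      exact dual_mem_polyFun (LinearMap.proj (R := ℂ) (φ := fun _ : κ => ℂ) (.inl ⟨(i, l), h⟩))
    · simpa only [U, dif_neg h] using const_mem_polyFun 0
  have hUdual : ∀ φ : Module.Dual ℂ (Tuples n r), (fun y => φ (U y)) ∈ polyFun (κ → ℂ) := fun φ => by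
    have : ∀ y, φ (U y) = ∑ k : Fin r × Fin (n + 1), U y k.1 k.2 * φ (unitTuple k) := fun y => by
      conv_lhs => rw [eq_sum_unitTuple (U y)]
      simp
    simp only [this]
    exact sum_mem_polyFun _ fun k _ => mul_mem_polyFun (hU _ _) (const_mem_polyFun _)
  have hM : ∀ a k, (fun y : κ → ℂ => y (.inr (a, k))) ∈ polyFun (κ → ℂ) := fun a k =>
    dual_mem_polyFun (LinearMap.proj (R := ℂ) (φ := fun _ : κ => ℂ) (.inr (a, k)))
  -- Scaling the free columns by the coordinate `j` of `u` keeps the solution of `L u = 0`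
  -- polynomial, with no division.
  let z : (Fin d × (Fin r × Fin (n + 1))) ⊕ Fin e → (κ → ℂ) → ℂ := Sum.elim
    (fun ak y => if h : ak.2 ≠ j then U y j.1 j.2 * y (.inr (ak.1, ⟨ak.2, h⟩))
      else -∑ k : {k // k ≠ j}, U y k.1.1 k.1.2 * y (.inr (ak.1, k)))
    (fun s y => x s (powerSum m (U y)))
  have hz : ∀ i, z i ∈ polyFun (κ → ℂ) := by
    rintro (⟨a, k⟩ | s)
    · by_cases h : k ≠ j
      · simpa only [z, Sum.elim_inl, dif_pos h] using mul_mem_polyFun (hU _ _) (hM _ _)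
      · simp only [z, Sum.elim_inl, dif_neg h]
        exact neg_mem (sum_mem_polyFun _ fun k _ => mul_mem_polyFun (hU _ _) (hM _ _))
    · exact comp_mem_polyFun hUdual (comp_powerSum_mem_polyFun (hx s))
  have hcard : Fintype.card κ < Fintype.card ((Fin d × (Fin r × Fin (n + 1))) ⊕ Fin e) := by
    simp only [κ, Fintype.card_sum, Fintype.card_prod, Fintype.card_fin, ne_eq,
      Fintype.card_subtype_compl, Fintype.card_subtype_eq]
    have hpos : 0 < r * (n + 1) := Nat.mul_pos b.1.pos (Nat.succ_pos n)
    rw [← hed] at hpos ⊢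
    obtain ⟨N, hN⟩ : ∃ N, e + d = N + 1 := ⟨e + d - 1, by omega⟩
    rw [hN, Nat.add_sub_cancel, Nat.mul_succ]
    omega
  obtain ⟨q, hq, hqz⟩ := exists_relation hcard z hz
  refine ⟨q, hq, fun u L hub huj hLu => ?_⟩
  let y : κ → ℂ := Sum.elim (fun k => u k.1.1 k.1.2)
    (fun ak => L (unitTuple ak.2.1) ak.1 / u j.1 j.2)
  have hUy : U y = u := by
    ext i l
    by_cases h : (i, l) ≠ b
    · simp only [U, dif_pos h, y, Sum.elim_inl]
    · simp only [U, dif_neg h]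
      rw [not_not] at h
      subst h
      exact hub.symm
  convert hqz y using 3
  ext i
  rcases i with ⟨a, k⟩ | s
  · simp only [Sum.elim_inl, z, hUy]
    by_cases h : k ≠ j
    · rw [dif_pos h]
      simp only [y, Sum.elim_inr]
      field_simp
    · rw [dif_neg h]
      rw [not_not] at h
      subst h
      have h0 := congrFun hLu a
      rw [map_tuple_apply, Fintype.sum_eq_add_sum_subtype_ne _ k] at h0
      simp only [y, Sum.elim_inr, mul_div_assoc', ← Finset.sum_div]
      rw [Pi.zero_apply] at h0
      rw [eq_neg_iff_add_eq_zero, ← mul_right_inj' huj, mul_add, mul_div_cancel₀ _ huj, h0,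
        mul_zero]
  · simp only [Sum.elim_inr, z, hUy]

/-- View `q` as a polynomial in the `S` variables with coefficients in the `T` variables. Some
nonzero coefficient survives at a suitable `u`, after which a suitable `w` exists. -/
theorem exists_eval_sumElim_ne_zero {S T X : Type*} {x : T → X → ℂ}
    (hind : ∀ c : MvPolynomial T ℂ, c ≠ 0 → ∃ u, MvPolynomial.eval (fun s => x s u) c ≠ 0)
    {q : MvPolynomial (S ⊕ T) ℂ} (hq : q ≠ 0) :
    ∃ u w, MvPolynomial.eval (Sum.elim w fun s => x s u) q ≠ 0 := by
  have hQ : MvPolynomial.sumRingEquiv ℂ S T q ≠ 0 := by simpa using hq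
  obtain ⟨s, hs⟩ := MvPolynomial.ne_zero_iff.1 hQ
  obtain ⟨u, hu⟩ := hind _ hs
  have hQu : MvPolynomial.map (MvPolynomial.eval fun s => x s u)
      (MvPolynomial.sumRingEquiv ℂ S T q) ≠ 0 :=
    MvPolynomial.ne_zero_iff.2 ⟨s, by rwa [MvPolynomial.coeff_map]⟩
  refine ⟨u, ?_⟩
  simp only [← eval_sumRingEquiv]
  by_contra! hcon
  exact hQu (MvPolynomial.funext fun w => by rw [hcon w, map_zero])

theorem eval_sumElim_mem_polyFun {V : Type*} [AddCommGroup V] [Module ℂ V] {T : Type*}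
    {x : T → V → ℂ} (hx : ∀ s, x s ∈ polyFun V)
    (q : MvPolynomial ((Fin d × (Fin r × Fin (n + 1))) ⊕ T) ℂ) :
    (fun v : V × (Tuples n r →ₗ[ℂ] (Fin d → ℂ)) => MvPolynomial.eval
      (Sum.elim (fun ak => v.2 (unitTuple ak.2) ak.1) (fun s => x s v.1)) q) ∈
      polyFun (V × (Tuples n r →ₗ[ℂ] (Fin d → ℂ))) := by
  have h : ∀ v : V × (Tuples n r →ₗ[ℂ] (Fin d → ℂ)),
      (Sum.elim (fun ak => v.2 (unitTuple ak.2) ak.1) (fun s => x s v.1) :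
        (Fin d × (Fin r × Fin (n + 1))) ⊕ T → ℂ) = fun i => (Sum.elim
        (fun ak v => v.2 (unitTuple ak.2) ak.1) (fun s v => x s v.1) :
        (Fin d × (Fin r × Fin (n + 1))) ⊕ T → V × (Tuples n r →ₗ[ℂ] (Fin d → ℂ)) → ℂ) i v :=
    fun v => by ext (_ | _) <;> rfl
  simp only [h]
  refine eval_mem_polyFun ?_ q
  rintro (⟨a, k⟩ | s)
  · exact map_unitTuple_mem_polyFun a k
  · exact comp_fst_mem_polyFun (hx s)

/-- A polynomial relation between the sum of powers of a tuple with one prescribed zero coordinate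
and one prescribed nonzero coordinate, and the linear maps that vanish at this tuple. -/
theorem exists_polyFun_vanishing_aux {e : ℕ} (hed : e + d = r * (n + 1))
    {x : Fin e → SymTensor n m → ℂ} (hx : ∀ s, x s ∈ polyFun (SymTensor n m))
    (hind : ∀ c : MvPolynomial (Fin e) ℂ, c ≠ 0 →
        ∃ u : Tuples n r, MvPolynomial.eval (fun s => x s (powerSum m u)) c ≠ 0)
    (b j : Fin r × Fin (n + 1)) :
    ∃ G ∈ polyFun (SymTensor n m × (Tuples n r →ₗ[ℂ] (Fin d → ℂ))),
      (∃ (u : Tuples n r) (L : Tuples n r →ₗ[ℂ] (Fin d → ℂ)), G (powerSum m u, L) ≠ 0) ∧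
      ∀ (u : Tuples n r) (L : Tuples n r →ₗ[ℂ] (Fin d → ℂ)), u b.1 b.2 = 0 → u j.1 j.2 ≠ 0 →
        L u = 0 → G (powerSum m u, L) = 0 := by
  obtain ⟨q, hq, hqz⟩ := exists_relation_of_map_eq_zero hed hx b j
  refine ⟨_, eval_sumElim_mem_polyFun hx q, ?_, hqz⟩
  obtain ⟨u, w, hw⟩ := exists_eval_sumElim_ne_zero hind hq
  obtain ⟨L, hL⟩ := exists_map_unitTuple_eq w
  refine ⟨u, L, ?_⟩
  simpa only [hL] using hw

theorem exists_polyFun_vanishing (hm : 1 ≤ m) (hr : 1 ≤ r) {e : ℕ}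
    (he : Cardinal.toNat (Algebra.trdeg ℂ (CoordinateRing (secant n m r))) = e)
    (hed : e + d = r * (n + 1)) :
    ∃ G ∈ polyFun (SymTensor n m × (Tuples n r →ₗ[ℂ] (Fin d → ℂ))),
      (∃ (u : Tuples n r) (L : Tuples n r →ₗ[ℂ] (Fin d → ℂ)), G (powerSum m u, L) ≠ 0) ∧
      ∀ (u : Tuples n r) (L : Tuples n r →ₗ[ℂ] (Fin d → ℂ)), ∏ i, u i 0 = 0 → u ≠ 0 → L u = 0 →
        G (powerSum m u, L) = 0 := by
  classical
  obtain ⟨x, hx, hind⟩ := exists_independent_values (n := n) hm hr he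
  -- A nonzero tuple with a vanishing leading coordinate has a nonzero coordinate elsewhere, so
  -- these finitely many pairs of positions cover every bad tuple.
  choose G hG hG0 hGv using fun bj : {bj : Fin r × (Fin r × Fin (n + 1)) // bj.2 ≠ (bj.1, 0)} =>
    exists_polyFun_vanishing_aux hed hx hind (bj.1.1, 0) bj.1.2
  refine ⟨fun v => ∏ bj, G bj v, prod_mem_polyFun _ fun bj _ => hG bj, ?_, ?_⟩
  · obtain ⟨⟨u, L⟩, h⟩ := exists_prod_ne_zero Finset.univ
      (f := fun bj (v : Tuples n r × (Tuples n r →ₗ[ℂ] (Fin d → ℂ))) => G bj (powerSum m v.1, v.2))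
      (fun bj _ => comp_powerSum_prod_mem_polyFun (hG bj))
      (fun bj _ => let ⟨u, L, h⟩ := hG0 bj; ⟨(u, L), h⟩)
    exact ⟨u, L, h⟩
  · intro u L hu hu0 hLu
    obtain ⟨b, -, hb⟩ := Finset.prod_eq_zero_iff.1 hu
    obtain ⟨i, hi⟩ := Function.ne_iff.1 hu0
    obtain ⟨l, hl⟩ := Function.ne_iff.1 hi
    have hne : (i, l) ≠ (b, 0) := by
      rintro ⟨⟩
      exact hl hb
    exact Finset.prod_eq_zero (Finset.mem_univ ⟨(b, (i, l)), hne⟩) (hGv _ u L hb hl hLu)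

end Relation

/-! ### From the vanishing function to general points -/

section Generic

variable {n m r d : ℕ}

theorem exists_smul_rep_eq_of_mem_fiber (hm : 1 ≤ m) {v : SymTensor n m} (hv : v ≠ 0)
    {u : ℙ ℂ (Tuples n r)} (hu : u ∈ fiber r (Projectivization.mk ℂ v hv)) :
    ∃ a : ℂ, a ≠ 0 ∧ powerSum m (a • u.rep) = v := by
  obtain ⟨h, hmk⟩ := hu
  obtain ⟨c, hc⟩ := (Projectivization.mk_eq_mk_iff ℂ _ _ hv h).1 hmk
  obtain ⟨a, ha, hpow⟩ := exists_smul_powerSum hm c.ne_zero u.rep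
  exact ⟨a, ha, hpow.trans hc⟩

theorem mem_U₀_of_vanishing (hm : 1 ≤ m)
    {G : SymTensor n m × (Tuples n r →ₗ[ℂ] (Fin d → ℂ)) → ℂ}
    (hG : ∀ (u : Tuples n r) (L : Tuples n r →ₗ[ℂ] (Fin d → ℂ)), ∏ i, u i 0 = 0 → u ≠ 0 →
      L u = 0 → G (powerSum m u, L) = 0)
    {v : SymTensor n m} (hv : v ≠ 0) {L : Tuples n r →ₗ[ℂ] (Fin d → ℂ)} (hGv : G (v, L) ≠ 0)
    {u : ℙ ℂ (Tuples n r)} (hu : u ∈ fiber r (Projectivization.mk ℂ v hv)) (hL : L u.rep = 0) :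
    u ∈ U₀ n r := by
  obtain ⟨a, ha, rfl⟩ := exists_smul_rep_eq_of_mem_fiber hm hv hu
  intro h0
  refine hGv (hG _ L ?_ (smul_ne_zero ha u.rep_nonzero) (by rw [map_smul, hL, smul_zero]))
  obtain ⟨i, hi, h⟩ := Finset.prod_eq_zero_iff.1 h0
  exact Finset.prod_eq_zero hi (by simp [h])

theorem exists_dual_ne_zero {V : Type*} [AddCommGroup V] [Module ℂ V] {v : V} (hv : v ≠ 0) :
    ∃ φ : Module.Dual ℂ V, φ v ≠ 0 := by
  by_contra! h
  exact hv ((Module.forall_dual_apply_eq_zero_iff ℂ v).1 h)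

theorem comp_prodMk_mem_polyFun {V H : Type*} [AddCommGroup V] [Module ℂ V] [AddCommGroup H]
    [Module ℂ H] (L : H) {g : V × H → ℂ} (hg : g ∈ polyFun (V × H)) :
    (fun v => g (v, L)) ∈ polyFun V := by
  refine comp_mem_polyFun (T := fun v => (v, L)) (fun φ => ?_) hg
  have h : (fun v => φ (v, L)) = fun v => (φ ∘ₗ LinearMap.inl ℂ V H) v + φ (0, L) := by
    ext v
    simp [← map_add]
  rw [h]
  exact add_mem (dual_mem_polyFun _) (const_mem_polyFun _)

theorem generically_fiber_subset_U₀ (hm : 1 ≤ m) (hr : 1 ≤ r)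
    (he : Cardinal.toNat (Algebra.trdeg ℂ (CoordinateRing (secant n m r))) = r * (n + 1)) :
    Generically (zariski (SymTensor n m)) (secant n m r) (fun F => fiber r F ⊆ U₀ n r) := by
  obtain ⟨G, hG, ⟨u₀, L₀, h₀⟩, hGv⟩ :=
    exists_polyFun_vanishing (n := n) (d := 0) hm hr he (add_zero _)
  obtain ⟨p, hp⟩ := mem_polyFun_iff.1 (comp_prodMk_mem_polyFun L₀ hG)
  have hpv : ∀ v, value p v = G (v, L₀) := congrFun hp
  -- Since `p` need not be homogeneous, the open set consists of the lines on which `p` is not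
  -- identically zero.
  refine ⟨⋃ k, {x | value (MvPolynomial.homogeneousComponent k p) x.rep ≠ 0}, ?_, ?_, ?_⟩
  · exact @isOpen_iUnion _ _ (zariski _) _ fun k =>
      isOpen_zariski_ne_zero (MvPolynomial.homogeneousComponent_isHomogeneous k p)
  · intro F hF
    refine (@mem_closure_iff _ (zariski _) _ _).2 fun O hO hFO => ?_
    obtain ⟨k, h, hh, hhF, hhO⟩ := exists_homogeneous_subset hO hFO
    obtain ⟨u₁, hu₁, hhu₁⟩ := exists_value_powerSum_ne_zero hm hF hhF
    obtain ⟨φ, hφ⟩ := exists_dual_ne_zero hu₁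
    obtain ⟨u, hu, hpu⟩ := exists_ne_zero_and_ne_zero (V := Tuples n r)
      (mul_mem_polyFun (dual_powerSum_mem_polyFun (n := n) φ)
        (comp_powerSum_mem_polyFun (value_mem_polyFun h)))
      (comp_powerSum_mem_polyFun (value_mem_polyFun p)) ⟨u₁, mul_ne_zero hφ hhu₁⟩
      ⟨u₀, by rwa [hpv]⟩
    have hu0 : powerSum m u ≠ 0 := fun h0 => left_ne_zero_of_mul hu (by rw [h0, map_zero])
    refine ⟨Projectivization.mk ℂ _ hu0,
      hhO _ ((value_mk_rep_ne_zero_iff hh hu0).2 (right_ne_zero_of_mul hu)),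
      mk_powerSum_mem_secant u hu0, Set.mem_iUnion.2 ?_⟩
    obtain ⟨l, hl⟩ := exists_homogeneousComponent_ne_zero hpu
    exact ⟨l, (value_mk_rep_ne_zero_iff
      (MvPolynomial.homogeneousComponent_isHomogeneous l p) hu0).2 hl⟩
  · rintro F ⟨-, hF⟩ u hu
    obtain ⟨k, hk⟩ := Set.mem_iUnion.1 hF
    obtain ⟨c, hc, hpc⟩ := exists_smul_ne_zero hk
    rw [hpv] at hpc
    have hc0 : c • F.rep ≠ 0 := smul_ne_zero hc F.rep_nonzero
    have hF' : F = Projectivization.mk ℂ _ hc0 := by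
      conv_lhs => rw [← F.mk_rep]
      exact (Projectivization.mk_eq_mk_iff' ℂ _ _ _ _).2 ⟨c⁻¹, inv_smul_smul₀ hc _⟩
    rw [hF'] at hu
    exact mem_U₀_of_vanishing hm hGv hc0 hpc hu (Subsingleton.elim _ _)

/-- With `s` a right inverse of some `L₀`, this determinant is a polynomial in `L`, equal to `1` at
`L₀`, and its nonvanishing forces `L` to be surjective. -/
theorem det_comp_mem_polyFun {E : Type*} [AddCommGroup E] [Module ℂ E] (s : (Fin d → ℂ) →ₗ[ℂ] E) :
    (fun L : E →ₗ[ℂ] (Fin d → ℂ) => LinearMap.det (L ∘ₗ s)) ∈ polyFun (E →ₗ[ℂ] (Fin d → ℂ)) := by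
  simp only [← LinearMap.det_toMatrix', Matrix.det_apply', LinearMap.toMatrix'_apply]
  refine sum_mem_polyFun _ fun σ _ => mul_mem_polyFun (const_mem_polyFun _)
    (prod_mem_polyFun _ fun i _ => ?_)
  exact dual_mem_polyFun ((LinearMap.proj (σ i) : (Fin d → ℂ) →ₗ[ℂ] ℂ) ∘ₗ
    (LinearMap.applyₗ (s (Pi.single i 1)) : (E →ₗ[ℂ] (Fin d → ℂ)) →ₗ[ℂ] (Fin d → ℂ)))

theorem surjective_of_det_comp_ne_zero {E : Type*} [AddCommGroup E] [Module ℂ E]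
    {s : (Fin d → ℂ) →ₗ[ℂ] E} {L : E →ₗ[ℂ] (Fin d → ℂ)} (h : LinearMap.det (L ∘ₗ s) ≠ 0) :
    Function.Surjective L := by
  have hs : Function.Surjective (L ∘ₗ s) := ((L ∘ₗ s).equivOfDetNeZero h).surjective
  exact Function.Surjective.of_comp hs

theorem exists_ofForms_eq {E : Type*} [AddCommGroup E] [Module ℂ E] [FiniteDimensional ℂ E]
    (S : Gr E d) : ∃ L, Gr.ofForms L = S := by
  have e : (E ⧸ S.1) ≃ₗ[ℂ] (Fin d → ℂ) := LinearEquiv.ofFinrankEq _ _ (by rw [S.2]; simp)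
  refine ⟨⟨e.toLinearMap ∘ₗ S.1.mkQ, e.surjective.comp S.1.mkQ_surjective⟩, Subtype.ext ?_⟩
  simp [Gr.ofForms]

section

variable {V E : Type*} [AddCommGroup V] [Module ℂ V] [AddCommGroup E] [Module ℂ E]

theorem Gr.ofForms_eq_iff {L L' : {L : E →ₗ[ℂ] (Fin d → ℂ) // Function.Surjective L}} :
    Gr.ofForms L = Gr.ofForms L' ↔ LinearMap.ker L.1 = LinearMap.ker L'.1 :=
  Subtype.ext_iff

theorem toPoint_eq_iff {q q' : Frames V E d} : q.toPoint = q'.toPoint ↔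
    ∃ (c : ℂˣ) (g : (Fin d → ℂ) ≃ₗ[ℂ] (Fin d → ℂ)),
      c • q.1.1 = q'.1.1 ∧ g.toLinearMap ∘ₗ q.1.2 = q'.1.2 := by
  rw [eq_comm, Frames.toPoint, Frames.toPoint, Prod.mk.injEq, Projectivization.mk_eq_mk_iff,
    Gr.ofForms_eq_iff]
  constructor
  · rintro ⟨⟨c, hc⟩, hker⟩
    refine ⟨c, (q.1.2.quotKerEquivOfSurjective q.2.2).symm.trans
      ((Submodule.quotEquivOfEq _ _ hker.symm).trans
        (q'.1.2.quotKerEquivOfSurjective q'.2.2)), hc, ?_⟩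
    ext1 x
    have hx : (q.1.2.quotKerEquivOfSurjective q.2.2).symm (q.1.2 x) = Submodule.Quotient.mk x :=
      (LinearEquiv.symm_apply_eq _).2 rfl
    simp only [LinearMap.comp_apply, LinearEquiv.coe_coe, LinearEquiv.trans_apply, hx]
    rfl
  · rintro ⟨c, g, hc, hg⟩
    exact ⟨⟨c, hc⟩, (congrArg LinearMap.ker hg).symm.trans (LinearEquiv.ker_comp g q.1.2)⟩

/-- The set of points of `ℙ(V) × Gr(E, d)` having homogeneous coordinates at which a given
polynomial function does not vanish is open. -/
theorem isOpen_zariskiProd_image {G : V × (E →ₗ[ℂ] (Fin d → ℂ)) → ℂ}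
    (hG : G ∈ polyFun (V × (E →ₗ[ℂ] (Fin d → ℂ)))) :
    IsOpen[zariskiProd V E d] (Frames.toPoint '' {q : Frames V E d | G q.1 ≠ 0}) := by
  -- By `toPoint_eq_iff`, the preimage of the image is the union of the translates of `{G ≠ 0}`
  -- under `GL_1 × GL_d`, each of them open.
  refine ⟨⋃ cg : ℂˣ × ((Fin d → ℂ) ≃ₗ[ℂ] (Fin d → ℂ)),
    {v | G (cg.1 • v.1, cg.2.toLinearMap ∘ₗ v.2) ≠ 0}, ?_, ?_⟩
  · refine @isOpen_iUnion _ _ (affineZariski _) _ fun cg => isOpen_affineZariski_ne_zero ?_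
    let T : V × (E →ₗ[ℂ] (Fin d → ℂ)) →ₗ[ℂ] V × (E →ₗ[ℂ] (Fin d → ℂ)) :=
      LinearMap.prodMap (cg.1.1 • LinearMap.id) (LinearMap.compRight ℂ cg.2.toLinearMap)
    exact comp_linear_mem_polyFun T hG
  · ext q
    simp only [Set.mem_preimage, Set.mem_iUnion, Set.mem_image, Set.mem_ofPred_eq, Prod.exists]
    constructor
    · rintro ⟨c, g, h⟩
      have hq : c • q.1.1 ≠ 0 ∧ Function.Surjective (g.toLinearMap ∘ₗ q.1.2) :=
        ⟨(smul_ne_zero_iff_ne c).2 q.2.1, g.surjective.comp q.2.2⟩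
      exact ⟨⟨(c • q.1.1, g.toLinearMap ∘ₗ q.1.2), hq⟩, h,
        (toPoint_eq_iff.2 ⟨c, g, rfl, rfl⟩).symm⟩
    · rintro ⟨q', h, hq'⟩
      obtain ⟨c, g, h1, h2⟩ := toPoint_eq_iff.1 hq'.symm
      exact ⟨c, g, by rwa [h1, h2]⟩

theorem exists_polyFun_toPoint_mem {O : Set (ℙ ℂ V × Gr E d)} (hO : IsOpen[zariskiProd V E d] O)
    {q : Frames V E d} (hq : q.toPoint ∈ O) :
    ∃ h ∈ polyFun (V × (E →ₗ[ℂ] (Fin d → ℂ))), h q.1 ≠ 0 ∧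
      ∀ q' : Frames V E d, h q'.1 ≠ 0 → q'.toPoint ∈ O := by
  obtain ⟨O', hO', heq⟩ := hO
  have hmem : ∀ q' : Frames V E d, q'.1 ∈ O' ↔ q'.toPoint ∈ O := fun q' => Set.ext_iff.1 heq q'
  obtain ⟨h, hh, hhq, hhO⟩ := exists_polyFun_subset hO' ((hmem q).2 hq)
  exact ⟨h, hh, hhq, fun q' hq' => (hmem q').1 (hhO _ hq')⟩

end

theorem generically_fiber_inter_subset_U₀ (hm : 1 ≤ m) (hr : 1 ≤ r) {e : ℕ}
    (he : Cardinal.toNat (Algebra.trdeg ℂ (CoordinateRing (secant n m r))) = e)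
    (hed : e + d = r * (n + 1)) :
    Generically (zariskiProd (SymTensor n m) (Tuples n r) d)
      (secant n m r ×ˢ (Set.univ : Set (Gr (Tuples n r) d)))
      (fun q => fiber r q.1 ∩ q.2.points ⊆ U₀ n r) := by
  obtain ⟨G, hG, ⟨u₀, M₀, h₀⟩, hGv⟩ := exists_polyFun_vanishing (n := n) (d := d) hm hr he hed
  refine ⟨_, isOpen_zariskiProd_image hG, ?_, ?_⟩
  · rintro ⟨F, S⟩ ⟨hF, -⟩
    refine (@mem_closure_iff _ (zariskiProd _ _ _) _ _).2 fun O hO hFO => ?_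
    obtain ⟨L₀, rfl⟩ := exists_ofForms_eq S
    have hq₀ : (F, Gr.ofForms L₀) =
        Frames.toPoint ⟨(F.rep, L₀.1), F.rep_nonzero, L₀.2⟩ := by
      simp [Frames.toPoint]
    rw [hq₀] at hFO
    obtain ⟨h, hh, hhq, hhO⟩ := exists_polyFun_toPoint_mem hO hFO
    obtain ⟨p, hp⟩ := mem_polyFun_iff.1 (comp_prodMk_mem_polyFun L₀.1 hh)
    obtain ⟨u₁, hu₁, hpu₁⟩ := exists_value_powerSum_ne_zero hm hF (p := p) (by rwa [hp])
    rw [hp] at hpu₁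
    obtain ⟨φ, hφ⟩ := exists_dual_ne_zero hu₁
    obtain ⟨s, hs⟩ := L₀.1.exists_rightInverse_of_surjective (LinearMap.range_eq_top.2 L₀.2)
    -- The factors `φ` and `det` guarantee that `(powerSum m u, L)` is a legitimate frame; `h`
    -- places it in `O` and `G` in the good locus.
    obtain ⟨⟨u, L⟩, h1, h2⟩ := exists_ne_zero_and_ne_zero
      (V := Tuples n r × (Tuples n r →ₗ[ℂ] (Fin d → ℂ)))
      (mul_mem_polyFun (mul_mem_polyFun
        (comp_fst_mem_polyFun (dual_powerSum_mem_polyFun (n := n) φ))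
        (comp_snd_mem_polyFun (det_comp_mem_polyFun s))) (comp_powerSum_prod_mem_polyFun hh))
      (comp_powerSum_prod_mem_polyFun hG)
      ⟨(u₁, L₀.1), mul_ne_zero (mul_ne_zero hφ (by simp [hs])) hpu₁⟩ ⟨(u₀, M₀), h₀⟩
    have hu0 : powerSum m u ≠ 0 := fun h0 =>
      left_ne_zero_of_mul (left_ne_zero_of_mul h1) (by simp [h0])
    have hL := surjective_of_det_comp_ne_zero (right_ne_zero_of_mul (left_ne_zero_of_mul h1))
    let q : Frames (SymTensor n m) (Tuples n r) d := ⟨(powerSum m u, L), hu0, hL⟩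
    exact ⟨q.toPoint, hhO q (right_ne_zero_of_mul h1),
      ⟨mk_powerSum_mem_secant u hu0, trivial⟩, q, h2, rfl⟩
  · rintro _ ⟨-, q, hq, rfl⟩ u ⟨hu, huS⟩
    refine mem_U₀_of_vanishing hm hGv q.2.1 hq hu ?_
    have : u.submodule ≤ LinearMap.ker q.1.2 := huS
    rw [Projectivization.submodule_eq, Submodule.span_singleton_le_iff_mem] at this
    exact this

end Generic

end SymDecomp

theorem mainTheorem7 (n m r : ℕ) (hm : 1 ≤ m) (hr : 1 ≤ r) (d : ℕ)
    (hd : (d : ℤ) = r * (n + 1) - 1 - SymDecomp.projDim (SymDecomp.secant n m r)) :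
    (d = 0 →
      SymDecomp.Generically (SymDecomp.zariski (SymDecomp.SymTensor n m))
        (SymDecomp.secant n m r)
        (fun F => SymDecomp.fiber r F ⊆ SymDecomp.U₀ n r)) ∧
    (0 < d →
      SymDecomp.Generically
        (SymDecomp.zariskiProd (SymDecomp.SymTensor n m) (SymDecomp.Tuples n r) d)
        (SymDecomp.secant n m r ×ˢ (Set.univ : Set (SymDecomp.Gr (SymDecomp.Tuples n r) d)))
        (fun q => SymDecomp.fiber r q.1 ∩ q.2.points ⊆ SymDecomp.U₀ n r)) := by
  have hed : Cardinal.toNat (Algebra.trdeg ℂ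
      (SymDecomp.CoordinateRing (SymDecomp.secant n m r))) + d = r * (n + 1) := by
    rw [SymDecomp.projDim] at hd
    zify
    linarith
  refine ⟨fun h0 => ?_, fun _ => SymDecomp.generically_fiber_inter_subset_U₀ hm hr rfl hed⟩
  subst h0
  exact SymDecomp.generically_fiber_subset_U₀ hm hr hed
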